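/- Let $\Lambda$ be a finite, totally ordered set of fermionic modes and let $(a_i)_{i\in\Lambda}$ be the annihilation operators on the Fock space $\mathbb C^{2^{|\Lambda|}}$, so that $a_ia_j+a_ja_i=0$ and $a_ia_j^*+a_j^*a_i=\delta_{i,j}\mathbf 1$. For $K\subseteq\Lambda$ let $\mathcal A(K)\cong M_{2^{|K|}}(\mathbb C)$ be the unital $*$-algebra generated by $\{a_i: i\in K\}$. For a state $\varphi$ (positive normalized linear functional) on $\mathcal A(K)$ let $S(\varphi)=-\mathrm{Tr}\,D\log D$ be its von Neumann entropy, where $\mathrm{Tr}$ is the matrix trace of $\mathcal A(K)$ (equal to one on minimal projections), $D\in\mathcal A(K)$ is the density matrix of $\varphi$, $\varphi(X)=\mathrm{Tr}(DX)$, and $0\log 0=0$. The support of $\varphi$ is the smallest projection $p\in\mathcal A(K)$ with $\varphi(p)=1$. For $K\subseteq L$ and a state $\omega$ on $\mathcal A(L)$, $\omega_K$ denotes its restriction to $\mathcal A(K)$. Let $I,J\subseteq\Lambda$. A product state extension $\omega_1\circ\omega_2\circ\omega_3$ of states $\omega_1,\omega_2,\omega_3$ on $\mathcal A(I\setminus J)$,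 $\mathcal A(I\cap J)$, $\mathcal A(J\setminus I)$ is a state on $\mathcal A(I\cup J)$ such that $$(\omega_1\circ\omega_2\circ\omega_3)(ABC)=\omega_1(A)\,\omega_2(B)\,\omega_3(C)$$ for all $A\in\mathcal A(I\setminus J)$, $B\in\mathcal A(I\cap J)$, $C\in\mathcal A(J\setminus I)$. **Proposition.** Let $\omega$ be a state on $\mathcal A(I\cup J)$ which is separable for $\mathcal A(I\setminus J)$, $\mathcal A(I\cap J)$, $\mathcal A(J\setminus I)$ in the following sense: $$\omega=\sum_{i}\lambda_i\;\omega_{1,i}\circ\omega_{2,i}\circ\omega_{3,i}$$ is a finite sum with $\lambda_i>0$, $\sum_i\lambda_i=1$, where $\omega_{1,i}$, $\omega_{2,i}$, $\omega_{3,i}$ are states on $\mathcal A(I\setminus J)$, $\mathcal A(I\cap J)$, $\mathcal A(J\setminus I)$ whose product state extension $\omega_{1,i}\circ\omega_{2,i}\circ\omega_{3,i}$ exists for every $i$, and where, for each $k\in\{1,2,3\}$, the states $\omega_{k,i}$ and $\omega_{k,j}$ have orthogonal supports whenever $i\neq j$. Then $\omega$ satisfies strong subadditivity of the entropy with equality: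 $$S(\omega)+S(\omega_{I\cap J})=S(\omega_I)+S(\omega_J).$$ -/

import Mathlib

open scoped ComplexOrder

noncomputable section

namespace CAR

variable {Λ : Type*} [Fintype Λ] [LinearOrder Λ]

/-- Operators on the fermionic Fock space over the finite set of modes `Λ`, as matrices in the
occupation number basis: the basis vector of `T : Finset Λ` has exactly the modes in `T`
occupied. -/
abbrev Op (Λ : Type*) : Type _ := Matrix (Finset Λ) (Finset Λ) ℂ

/-- The annihilation operator of the mode `i`. It sends the basis vector of `T` to `0` if `i ∉ T`,
and otherwise to the basis vector of `T.erase i` with the Jordan-Wigner sign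
`(-1) ^ #{j ∈ T | j < i}`. -/
def annihilation (i : Λ) : Op Λ := fun S T =>
  if i ∈ T ∧ S = T.erase i then (-1) ^ (T.filter (· < i)).card else 0

theorem sign_erase {Λ : Type*} [LinearOrder Λ] (i j : Λ) (T : Finset Λ) (hj : j ∈ T) :
    (-1 : ℂ) ^ ((T.erase j).filter (· < i)).card =
      (if j < i then -1 else 1) * (-1) ^ (T.filter (· < i)).card := by
  rw [Finset.filter_erase]
  split_ifs with h
  · have hm : j ∈ T.filter (· < i) := by simp [hj, h]
    rw [← Finset.card_erase_add_one hm, pow_succ]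
    ring
  · rw [Finset.erase_eq_of_notMem (by simp [h]), one_mul]

theorem mul_annihilation_apply (M : Op Λ) (j : Λ) (S T : Finset Λ) :
    (M * annihilation j) S T =
      if j ∈ T then M S (T.erase j) * (-1) ^ (T.filter (· < j)).card else 0 := by
  rw [Matrix.mul_apply]
  by_cases h : j ∈ T <;> simp [annihilation, h]

theorem mul_star_annihilation_apply (M : Op Λ) (j : Λ) (S T : Finset Λ) :
    (M * star (annihilation j)) S T =
      if j ∈ T then 0 else M S (insert j T) * (-1) ^ (T.filter (· < j)).card := by
  rw [Matrix.mul_apply]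
  by_cases h : j ∈ T
  · rw [if_pos h]
    refine Finset.sum_eq_zero fun U _ => ?_
    have : ¬ (j ∈ U ∧ T = U.erase j) := by rintro ⟨_, rfl⟩; simp at h
    simp [Matrix.star_apply, annihilation, this]
  · rw [if_neg h, Finset.sum_eq_single (insert j T)]
    · simp [Matrix.star_apply, annihilation, h, Finset.filter_insert]
    · intro U _ hU
      have : ¬ (j ∈ U ∧ T = U.erase j) := by
        rintro ⟨hj, rfl⟩; exact hU (Finset.insert_erase hj).symm
      simp [Matrix.star_apply, annihilation, this]
    · simp

/-- The canonical anticommutation relations `a i a j + a j a i = 0`. -/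
theorem annihilation_anticomm (i j : Λ) :
    annihilation i * annihilation j + annihilation j * annihilation i = 0 := by
  ext S T
  simp only [Matrix.add_apply, mul_annihilation_apply, Matrix.zero_apply]
  rcases eq_or_ne i j with rfl | hij
  · simp [annihilation]
  by_cases hi : i ∈ T <;> by_cases hj : j ∈ T <;>
    simp [annihilation, hi, hj, hij, hij.symm, sign_erase]
  rw [Finset.erase_right_comm]
  rcases lt_or_gt_of_ne hij with h | h <;> split_ifs <;> simp_all [not_lt_of_gt] <;> ring

/-- The canonical anticommutation relations `a i (a j)* + (a j)* a i = δ i j`. -/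
theorem annihilation_star_anticomm (i j : Λ) :
    annihilation i * star (annihilation j) + star (annihilation j) * annihilation i =
      if i = j then 1 else 0 := by
  ext S T
  simp only [Matrix.add_apply, mul_annihilation_apply, mul_star_annihilation_apply]
  rcases eq_or_ne i j with rfl | hij
  · by_cases hi : i ∈ T
    · by_cases hS : S = T
      · subst hS
        simp [annihilation, hi, Matrix.star_apply, ← mul_pow]
      · have : ¬ (i ∈ S ∧ T.erase i = S.erase i) := by
          rintro ⟨h1, h2⟩
          exact hS (by rw [← Finset.insert_erase h1, ← h2, Finset.insert_erase hi])
        simp [annihilation, hi, Matrix.star_apply, hS, this]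
    · by_cases hS : S = T <;>
        simp [annihilation, hi, Matrix.one_apply, hS, Finset.filter_insert, ← mul_pow]
  · by_cases hi : i ∈ T <;> by_cases hj : j ∈ T <;>
      simp [annihilation, hi, hj, hij, Matrix.star_apply]
    · intro _ h
      have : j ∈ T.erase i := by simp [hj, hij.symm]
      rw [h] at this
      simp at this
    · have key : (S = (insert j T).erase i) ↔ (j ∈ S ∧ T.erase i = S.erase j) := by
        constructor
        · rintro rfl
          refine ⟨by simp [hij.symm], ?_⟩
          rw [Finset.erase_right_comm, Finset.erase_insert hj]
        · rintro ⟨h1, h2⟩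
          rw [← Finset.insert_erase h1, ← h2, Finset.erase_insert_of_ne hij.symm]
      have hs := sign_erase i j (insert j T) (by simp)
      rw [Finset.erase_insert hj] at hs
      by_cases hk : j ∈ S ∧ T.erase i = S.erase j
      · have h3 := sign_erase j i T hi
        rw [hk.2, Finset.filter_erase, Finset.erase_eq_of_notMem (by simp)] at h3
        rw [if_pos (key.2 hk), if_pos hk]
        simp only [h3, hs]
        rcases lt_or_gt_of_ne hij with h | h <;> simp [h, not_lt_of_gt h] <;> ring
      · rw [if_neg (fun h => hk (key.1 h)), if_neg hk]
        simp

/-- The algebra `𝒜(K)`: the unital star-subalgebra generated by the annihilation operators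
`a i`, `i ∈ K`. -/
def localAlgebra (K : Finset Λ) : StarSubalgebra ℂ (Op Λ) :=
  StarAlgebra.adjoin ℂ (annihilation '' (K : Set Λ))

theorem localAlgebra_mono {K L : Finset Λ} (h : K ⊆ L) : localAlgebra K ≤ localAlgebra L :=
  StarAlgebra.adjoin_le (fun _ hx => StarAlgebra.subset_adjoin ℂ _
    (Set.image_mono (Finset.coe_subset.2 h) hx))

/-- The inclusion `𝒜(K) ⊆ 𝒜(L)` for `K ⊆ L`. -/
def incl {K L : Finset Λ} (h : K ⊆ L) : localAlgebra K →⋆ₐ[ℂ] localAlgebra L :=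
  StarSubalgebra.inclusion (localAlgebra_mono h)

/-- A state on `𝒜(K)`: a positive normalized linear functional. -/
structure State (K : Finset Λ) where
  toFun : localAlgebra K →ₗ[ℂ] ℂ
  nonneg : ∀ X : localAlgebra K, 0 ≤ toFun (star X * X)
  map_one : toFun 1 = 1

instance (K : Finset Λ) : CoeFun (State K) (fun _ => localAlgebra K → ℂ) where
  coe φ := φ.toFun

/-- The restriction of a state on `𝒜(L)` to `𝒜(K)`, where `K ⊆ L`. -/
def State.restrict {K L : Finset Λ} (ω : State L) (h : K ⊆ L) : State K where
  toFun := ω.toFun ∘ₗ (incl h).toAlgHom.toLinearMap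
  nonneg X := by simpa [← map_star] using ω.nonneg (incl h X)
  map_one := by simpa using ω.map_one

/-- The trace of the full matrix algebra `𝒜(K) ≅ M_{2 ^ |K|}(ℂ)`, normalized so that minimal
projections of `𝒜(K)` have trace one. The trace of the Fock space gives them the multiplicity
`2 ^ (|Λ| - |K|)`, which is divided out. -/
def localTrace (K : Finset Λ) (X : Op Λ) : ℂ :=
  (2 : ℂ) ^ K.card / (2 : ℂ) ^ Fintype.card Λ * X.trace

theorem exists_density (K : Finset Λ) (φ : localAlgebra K →ₗ[ℂ] ℂ) :
    ∃ D : localAlgebra K, ∀ X : localAlgebra K, φ X = localTrace K (D * X : Op Λ) := by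
  let B : localAlgebra K →ₗ[ℂ] (localAlgebra K →ₗ[ℂ] ℂ) :=
    LinearMap.mk₂ ℂ (fun D X => localTrace K (D * X : Op Λ))
      (by intros; simp [localTrace, add_mul, mul_add])
      (by intros; simp [localTrace, mul_left_comm])
      (by intros; simp [localTrace, mul_add])
      (by intros; simp [localTrace, mul_left_comm])
  have hc : (2 : ℂ) ^ K.card / (2 : ℂ) ^ Fintype.card Λ ≠ 0 := by simp
  have hinj : Function.Injective B := by
    rw [injective_iff_map_eq_zero]
    intro D hD
    have h : localTrace K (D * star (D : Op Λ) : Op Λ) = 0 := by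
      exact LinearMap.congr_fun hD (star D)
    have h' : (D * star (D : Op Λ) : Op Λ).trace = 0 :=
      (mul_eq_zero.1 h).resolve_left hc
    rw [Matrix.star_eq_conjTranspose, Matrix.trace_mul_conjTranspose_self_eq_zero_iff] at h'
    exact Subtype.ext h'
  have : FiniteDimensional ℂ (localAlgebra K) :=
    FiniteDimensional.finiteDimensional_submodule (localAlgebra K).toSubalgebra.toSubmodule
  have hsurj : Function.Surjective B :=
    (LinearMap.injective_iff_surjective_of_finrank_eq_finrank
      (Subspace.dual_finrank_eq (K := ℂ) (V := localAlgebra K)).symm).1 hinj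
  obtain ⟨D, hD⟩ := hsurj φ
  exact ⟨D, fun X => by rw [← hD]; rfl⟩

/-- The density matrix of a state `φ` on `𝒜(K)`: the (unique) `D ∈ 𝒜(K)` with
`φ X = Tr (D X)` for all `X ∈ 𝒜(K)`. -/
def State.density {K : Finset Λ} (φ : State K) : Op Λ :=
  (exists_density K φ.toFun).choose

/-- The von Neumann entropy `S(φ) = -Tr (D log D)` of a state on `𝒜(K)`, where `D` is its
density matrix, with the convention `0 log 0 = 0`. -/
def State.entropy {K : Finset Λ} (φ : State K) : ℝ :=
  (localTrace K (cfc Real.negMulLog φ.density)).re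

/-- `p` is the support of the state `φ`: the smallest projection of `𝒜(K)` on which `φ`
equals one (for projections, `p ≤ q` means `p * q = p`). -/
def State.IsSupport {K : Finset Λ} (φ : State K) (p : localAlgebra K) : Prop :=
  IsStarProjection p ∧ φ p = 1 ∧
    ∀ q : localAlgebra K, IsStarProjection q → φ q = 1 → p * q = p

/-- Two states on `𝒜(K)` have orthogonal supports. -/
def State.Orthogonal {K : Finset Λ} (φ ψ : State K) : Prop :=
  ∃ p q : localAlgebra K, φ.IsSupport p ∧ ψ.IsSupport q ∧ p * q = 0

/-- `ω` is a product state extension `ω₁ ∘ ω₂ ∘ ω₃` to `𝒜(I ∪ J)` of states on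
`𝒜(I \ J)`, `𝒜(I ∩ J)`, `𝒜(J \ I)`. -/
def IsProductExtension {I J : Finset Λ} (ω : State (I ∪ J))
    (ω₁ : State (I \ J)) (ω₂ : State (I ∩ J)) (ω₃ : State (J \ I)) : Prop :=
  ∀ (A : localAlgebra (I \ J)) (B : localAlgebra (I ∩ J)) (C : localAlgebra (J \ I)),
    ω (incl (Finset.sdiff_subset.trans Finset.subset_union_left) A *
        incl (Finset.inter_subset_left.trans Finset.subset_union_left) B *
        incl (Finset.sdiff_subset.trans Finset.subset_union_right) C) =
      ω₁ A * ω₂ B * ω₃ C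

end CAR

end

/-! A fermionic product state behaves like a tensor product state once parity is controlled. Odd
elements of disjoint regions anticommute, so a state that factorizes over two regions can have an
odd part on at most one of them (`State.even_or_even`). Hence at most one of the three densities in
a product extension fails to be even, the three commute pairwise, and their product is the density
of the extension (`IsProductExtension.density_eq`).

The normalized traces of disjoint regions are independent (`localTrace_mul`), so each restriction of
`ω` is obtained by deleting factors from `∑ λᵢ D₁ᵢ D₂ᵢ D₃ᵢ`. The factor `D₂ᵢ` survives in all four
densities, and orthogonality of the `D₂ᵢ` makes each of the four sums orthogonal. With `η(x) = -x
log x`, an orthogonal mixture has entropy `∑ η(λᵢ) + λᵢ Sᵢ` (`State.entropy_eq_sum`), and `Sᵢ` is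
additive over the factors (`localTrace_cfc_negMulLog_mul`). Both sides of the claim are then `∑ 2
η(λᵢ) + λᵢ (S₁ᵢ + 2 S₂ᵢ + S₃ᵢ)`. -/

namespace CAR

variable {Λ : Type*} [Fintype Λ] [LinearOrder Λ]

/-! ### Parity and graded commutation of disjoint regions -/

/-- The parity operator `(-1) ^ N`. -/
def parity (Λ : Type*) [Fintype Λ] [LinearOrder Λ] : Op Λ :=
  Matrix.diagonal fun S => (-1) ^ S.card

theorem parity_mul_parity : parity Λ * parity Λ = 1 := by
  simp [parity, Matrix.diagonal_mul_diagonal, ← mul_pow]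

theorem star_parity : star (parity Λ) = parity Λ := by
  rw [parity, Matrix.star_eq_conjTranspose, Matrix.diagonal_conjTranspose]
  congr 1
  ext S
  simp

theorem parity_mul_annihilation (i : Λ) :
    parity Λ * annihilation i = -(annihilation i * parity Λ) := by
  ext S T
  rw [parity, Matrix.diagonal_mul, Matrix.neg_apply, Matrix.mul_diagonal]
  unfold annihilation
  split_ifs with h
  · obtain ⟨h1, rfl⟩ := h
    rw [← Finset.card_erase_add_one h1, pow_succ]
    ring
  · simp

theorem parity_mul_star_annihilation (i : Λ) :
    parity Λ * star (annihilation i) = -(star (annihilation i) * parity Λ) := by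
  have h := congrArg star (parity_mul_annihilation i)
  rw [star_neg, star_mul, star_mul, star_parity] at h
  rw [h, neg_neg]

theorem annihilation_mul_apply (M : Op Λ) (j : Λ) (S T : Finset Λ) :
    (annihilation j * M) S T =
      if j ∈ S then 0 else (-1) ^ (S.filter (· < j)).card * M (insert j S) T := by
  have h := congrArg star (mul_star_annihilation_apply (star M) j T S)
  rw [← Matrix.star_apply, star_mul, star_star, star_star] at h
  rw [h]
  split_ifs
  · simp
  · simp [Matrix.star_apply, mul_comm]

theorem annihilation_mem {K : Finset Λ} {i : Λ} (hi : i ∈ K) :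
    annihilation i ∈ localAlgebra K :=
  StarAlgebra.subset_adjoin ℂ _ ⟨i, hi, rfl⟩

/-- Induction over the algebra `𝒜(K)` through its generators. -/
theorem localAlgebra_induction {K : Finset Λ} {p : ∀ X : Op Λ, X ∈ localAlgebra K → Prop}
    (ann : ∀ i (hi : i ∈ K), p (annihilation i) (annihilation_mem hi))
    (cre : ∀ i (hi : i ∈ K), p (star (annihilation i)) (star_mem (annihilation_mem hi)))
    (algebraMap : ∀ c : ℂ, p (algebraMap ℂ (Op Λ) c) (algebraMap_mem _ c))
    (add : ∀ X Y hX hY, p X hX → p Y hY → p (X + Y) (add_mem hX hY))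
    (mul : ∀ X Y hX hY, p X hX → p Y hY → p (X * Y) (mul_mem hX hY))
    {X : Op Λ} (hX : X ∈ localAlgebra K) : p X hX := by
  refine Algebra.adjoin_induction (s := _) (p := p) (fun x hx => ?_) algebraMap add mul hX
  rcases hx with ⟨i, hi, rfl⟩ | ⟨i, hi, h⟩
  · exact ann i hi
  · obtain rfl : x = star (annihilation i) := by rw [h, star_star]
    exact cre i hi

theorem parity_conj_mem {K : Finset Λ} {X : Op Λ} (hX : X ∈ localAlgebra K) :
    parity Λ * X * parity Λ ∈ localAlgebra K := by
  induction hX using localAlgebra_induction with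
  | ann i hi =>
    rw [parity_mul_annihilation, neg_mul, mul_assoc, parity_mul_parity, mul_one]
    exact neg_mem (annihilation_mem hi)
  | cre i hi =>
    rw [parity_mul_star_annihilation, neg_mul, mul_assoc, parity_mul_parity, mul_one]
    exact neg_mem (star_mem (annihilation_mem hi))
  | algebraMap c =>
    rw [← Algebra.commutes, mul_assoc, parity_mul_parity, mul_one]
    exact algebraMap_mem _ c
  | add X Y _ _ hX hY =>
    rw [mul_add, add_mul]
    exact add_mem hX hY
  | mul X Y _ _ hX hY =>
    have h : parity Λ * (X * Y) * parity Λ =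
        (parity Λ * X * parity Λ) * (parity Λ * Y * parity Λ) := by
      simp only [mul_assoc]
      rw [← mul_assoc (parity Λ) (parity Λ), parity_mul_parity, one_mul]
    rw [h]
    exact mul_mem hX hY

/-- A generator of `𝒜(K)` changes sign both when it passes `annihilation j` and when it passes the
parity; the two signs cancel. This Klein twist turns anticommutation into genuine commutation. -/
theorem commute_parity_mul_annihilation {K : Finset Λ} {X : Op Λ} (hX : X ∈ localAlgebra K)
    {j : Λ} (hj : j ∉ K) : Commute X (parity Λ * annihilation j) := by
  induction hX using localAlgebra_induction with
  | ann i hi =>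
    have h := annihilation_anticomm i j
    rw [Commute, SemiconjBy, ← mul_assoc, mul_assoc (parity Λ), eq_neg_of_add_eq_zero_right h,
      mul_neg, ← mul_assoc, parity_mul_annihilation, neg_mul, neg_neg]
  | cre i hi =>
    have h := annihilation_star_anticomm j i
    rw [if_neg (by rintro rfl; exact hj hi)] at h
    rw [Commute, SemiconjBy, ← mul_assoc, mul_assoc (parity Λ), eq_neg_of_add_eq_zero_left h,
      mul_neg, ← mul_assoc, parity_mul_star_annihilation, neg_mul, neg_neg]
  | algebraMap c => exact Algebra.commutes c _
  | add X Y _ _ hX hY => exact hX.add_left hY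
  | mul X Y _ _ hX hY => exact hX.mul_left hY

theorem annihilation_mul_eq {K : Finset Λ} {X : Op Λ} (hX : X ∈ localAlgebra K)
    {j : Λ} (hj : j ∉ K) :
    annihilation j * X = parity Λ * X * parity Λ * annihilation j := by
  rw [mul_assoc (parity Λ * X), mul_assoc (parity Λ) X,
    (commute_parity_mul_annihilation hX hj).eq, ← mul_assoc, ← mul_assoc, parity_mul_parity,
    one_mul]

theorem star_annihilation_mul_eq {K : Finset Λ} {X : Op Λ} (hX : X ∈ localAlgebra K)
    {j : Λ} (hj : j ∉ K) :
    star (annihilation j) * X = parity Λ * X * parity Λ * star (annihilation j) := by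
  -- Adjoint of the previous relation, applied to the parity conjugate of `star X`.
  have h := annihilation_mul_eq (parity_conj_mem (star_mem hX)) hj
  have h' := congrArg star h
  have hp (Y : Op Λ) : parity Λ * (parity Λ * Y) = Y := by
    rw [← mul_assoc, parity_mul_parity, one_mul]
  simp only [star_mul, star_star, star_parity, mul_assoc, hp, parity_mul_parity, mul_one] at h'
  simpa only [mul_assoc] using h'.symm

/-- An even element of a local algebra commutes with every element localized elsewhere. -/
theorem commute_of_even {K L : Finset Λ} (hKL : Disjoint K L) {X Y : Op Λ}
    (hX : X ∈ localAlgebra K) (hY : Y ∈ localAlgebra L) (h : Commute X (parity Λ)) :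
    Commute X Y := by
  have hc : parity Λ * X * parity Λ = X := by
    rw [← h.eq, mul_assoc, parity_mul_parity, mul_one]
  induction hY using localAlgebra_induction with
  | ann j hj =>
    have := annihilation_mul_eq hX (Finset.disjoint_right.1 hKL hj)
    rw [hc] at this
    exact this.symm
  | cre j hj =>
    have := star_annihilation_mul_eq hX (Finset.disjoint_right.1 hKL hj)
    rw [hc] at this
    exact this.symm
  | algebraMap c => exact (Algebra.commutes c X).symm
  | add Y Z _ _ hY hZ => exact hY.add_right hZ
  | mul Y Z _ _ hY hZ => exact hY.mul_right hZ

/-! ### Products of local algebras and independence of traces -/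

/-- The product of the local algebras of disjoint regions spans the algebra of their union. -/
theorem mem_span_mul {K L : Finset Λ} {X : Op Λ}
    (hX : X ∈ localAlgebra (K ∪ L)) :
    X ∈ Submodule.span ℂ
      {Z : Op Λ | ∃ A ∈ localAlgebra K, ∃ B ∈ localAlgebra L, Z = A * B} := by
  set M := Submodule.span ℂ
      {Z : Op Λ | ∃ A ∈ localAlgebra K, ∃ B ∈ localAlgebra L, Z = A * B} with hM
  have key (W : Op Λ) (hW : ∀ A ∈ localAlgebra K, ∀ B ∈ localAlgebra L, W * (A * B) ∈ M) :
      ∀ Z ∈ M, W * Z ∈ M := by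
    intro Z hZ
    induction hZ using Submodule.span_induction with
    | mem Z hZ =>
      obtain ⟨A, hA, B, hB, rfl⟩ := hZ
      exact hW A hA B hB
    | zero => rw [mul_zero]; exact zero_mem _
    | add Y Z _ _ hY hZ => rw [mul_add]; exact add_mem hY hZ
    | smul c Z _ hZ => rw [mul_smul_comm]; exact M.smul_mem c hZ
  have hmem {A B : Op Λ} (hA : A ∈ localAlgebra K) (hB : B ∈ localAlgebra L) : A * B ∈ M :=
    Submodule.subset_span ⟨A, hA, B, hB, rfl⟩
  -- The span is stable under left multiplication by each generator: one in `L` is moved past the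
  -- factor from `K` at the cost of a parity conjugation. Applying `X` to `1 ∈ M` concludes.
  have main : ∀ Z ∈ M, X * Z ∈ M := by
    induction hX using localAlgebra_induction with
    | ann i hi =>
      refine key _ fun A hA B hB => ?_
      by_cases hiK : i ∈ K
      · rw [← mul_assoc]
        exact hmem (mul_mem (annihilation_mem hiK) hA) hB
      · have hiL : i ∈ L := (Finset.mem_union.1 hi).resolve_left hiK
        rw [← mul_assoc, annihilation_mul_eq hA hiK, mul_assoc]
        exact hmem (parity_conj_mem hA) (mul_mem (annihilation_mem hiL) hB)
    | cre i hi =>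
      refine key _ fun A hA B hB => ?_
      by_cases hiK : i ∈ K
      · rw [← mul_assoc]
        exact hmem (mul_mem (star_mem (annihilation_mem hiK)) hA) hB
      · have hiL : i ∈ L := (Finset.mem_union.1 hi).resolve_left hiK
        rw [← mul_assoc, star_annihilation_mul_eq hA hiK, mul_assoc]
        exact hmem (parity_conj_mem hA) (mul_mem (star_mem (annihilation_mem hiL)) hB)
    | algebraMap c =>
      intro Z hZ
      rw [← Algebra.smul_def]
      exact M.smul_mem c hZ
    | add X Y _ _ hX hY => intro Z hZ; rw [add_mul]; exact add_mem (hX Z hZ) (hY Z hZ)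
    | mul X Y _ _ hX hY => intro Z hZ; rw [mul_assoc]; exact hX _ (hY Z hZ)
  have := main 1 (by simpa using hmem (one_mem (localAlgebra K)) (one_mem (localAlgebra L)))
  rwa [mul_one] at this

/-- Elements of `𝒜(K)` cannot change the occupation of a mode outside `K`: compare the entries at
`(S, insert j T)` in the twisted commutation relation. -/
theorem apply_eq_zero_of_mem {K : Finset Λ} {X : Op Λ} (hX : X ∈ localAlgebra K)
    {j : Λ} (hj : j ∉ K) {S T : Finset Λ} (hS : j ∈ S) (hT : j ∉ T) : X S T = 0 := by
  have h := congrFun (congrFun (commute_parity_mul_annihilation hX hj).eq S) (insert j T)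
  rw [← mul_assoc, mul_annihilation_apply, if_pos (Finset.mem_insert_self j T),
    Finset.erase_insert hT, mul_assoc, parity, Matrix.mul_diagonal, Matrix.diagonal_mul,
    annihilation_mul_apply, if_pos hS] at h
  simpa using h

theorem apply_eq_zero_of_inter_ne {K : Finset Λ} {X : Op Λ} (hX : X ∈ localAlgebra K)
    {j : Λ} (hj : j ∉ K) {S T : Finset Λ} (h : ¬ (j ∈ S ↔ j ∈ T)) : X S T = 0 := by
  by_cases hS : j ∈ S
  · exact apply_eq_zero_of_mem hX hj hS (by tauto)
  · have := apply_eq_zero_of_mem (star_mem hX) hj (S := T) (T := S) (by tauto) hS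
    simpa [Matrix.star_apply] using this

theorem apply_insert_insert {K : Finset Λ} {X : Op Λ} (hX : X ∈ localAlgebra K)
    {j : Λ} (hj : j ∉ K) {S : Finset Λ} (hS : j ∉ S) : X (insert j S) (insert j S) = X S S := by
  have h := congrFun (congrFun (commute_parity_mul_annihilation hX hj).eq S) (insert j S)
  rw [← mul_assoc, mul_annihilation_apply, if_pos (Finset.mem_insert_self j S),
    Finset.erase_insert hS, mul_assoc, parity, Matrix.mul_diagonal, Matrix.diagonal_mul,
    annihilation_mul_apply, if_neg hS, Finset.filter_insert, if_neg (lt_irrefl j)] at h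
  have h0 : ((-1 : ℂ) ^ S.card * (-1) ^ (S.filter (· < j)).card) ≠ 0 := by simp
  apply mul_left_cancel₀ h0
  linear_combination -h

theorem apply_self_eq_inter {K : Finset Λ} {X : Op Λ} (hX : X ∈ localAlgebra K)
    (S : Finset Λ) : X S S = X (S ∩ K) (S ∩ K) := by
  have key (U : Finset Λ) (hU : Disjoint U K) :
      X (U ∪ S ∩ K) (U ∪ S ∩ K) = X (S ∩ K) (S ∩ K) := by
    induction U using Finset.induction_on with
    | empty => simp
    | insert j U hj ih =>
      rw [Finset.disjoint_insert_left] at hU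
      rw [Finset.insert_union, apply_insert_insert hX hU.1 (by simp [hj, hU.1]), ih hU.2]
  have := key (S \ K) Finset.sdiff_disjoint
  rwa [Finset.sdiff_union_inter] at this

/-- If `S` and `T` differ at a mode `j`, then one of `K`, `L` misses `j`, and the corresponding
factor has vanishing `(S, T)` entry. -/
theorem trace_mul_eq_sum {K L : Finset Λ} (hKL : Disjoint K L) {A B : Op Λ}
    (hA : A ∈ localAlgebra K) (hB : B ∈ localAlgebra L) :
    (A * B).trace = ∑ S, A S S * B S S := by
  refine Finset.sum_congr rfl fun S _ => ?_
  rw [Matrix.diag_apply, Matrix.mul_apply]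
  refine Finset.sum_eq_single S (fun T _ hT => ?_) (by simp)
  obtain ⟨j, hj⟩ : ∃ j, ¬ (j ∈ T ↔ j ∈ S) := by
    by_contra! h
    exact hT (Finset.ext h)
  by_cases hjK : j ∈ K
  · rw [apply_eq_zero_of_inter_ne hB (Finset.disjoint_left.1 hKL hjK) hj, mul_zero]
  · rw [apply_eq_zero_of_inter_ne hA hjK (fun h => hj h.symm), zero_mul]

theorem sum_mul_sum_inter {K L : Finset Λ} (hKL : Disjoint K L) (a b : Finset Λ → ℂ) :
    (∑ S, a (S ∩ K)) * ∑ S, b (S ∩ L) =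
      2 ^ Fintype.card Λ * ∑ S, a (S ∩ K) * b (S ∩ L) := by
  -- The involution exchanges the parts of `S` and `T` outside `K`. It decouples the two sums, since
  -- `L` lies outside `K`.
  let σ : Finset Λ × Finset Λ → Finset Λ × Finset Λ := fun p =>
    (p.1 ∩ K ∪ p.2 \ K, p.2 ∩ K ∪ p.1 \ K)
  have hσ : Function.Involutive σ := by
    rintro ⟨S, T⟩
    simp only [σ, Prod.mk.injEq]
    constructor <;> ext x <;> simp <;> tauto
  have h : ∑ p : Finset Λ × Finset Λ, a (p.1 ∩ K) * b (p.1 ∩ L) =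
      ∑ p : Finset Λ × Finset Λ, a (p.1 ∩ K) * b (p.2 ∩ L) := by
    refine Fintype.sum_equiv hσ.toPerm _ _ ?_
    rintro ⟨S, T⟩
    have h1 : (S ∩ K ∪ T \ K) ∩ K = S ∩ K := by
      ext x; simp; tauto
    have h2 : (T ∩ K ∪ S \ K) ∩ L = S ∩ L := by
      ext x
      have : x ∈ K → x ∉ L := fun h => Finset.disjoint_left.1 hKL h
      simp; tauto
    simp [σ, h1, h2]
  rw [Finset.sum_mul_sum, ← Fintype.sum_prod_type', ← h, Fintype.sum_prod_type]
  simp [Finset.mul_sum]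

theorem trace_mul_trace {K L : Finset Λ} (hKL : Disjoint K L) {A B : Op Λ}
    (hA : A ∈ localAlgebra K) (hB : B ∈ localAlgebra L) :
    A.trace * B.trace = 2 ^ Fintype.card Λ * (A * B).trace := by
  rw [trace_mul_eq_sum hKL hA hB]
  have := sum_mul_sum_inter hKL (fun S => A S S) (fun S => B S S)
  simpa only [Matrix.trace, Matrix.diag_apply, ← apply_self_eq_inter hA,
    ← apply_self_eq_inter hB] using this

/-- The normalized traces of disjoint regions are independent. -/
theorem localTrace_mul {K L : Finset Λ} (hKL : Disjoint K L) {A B : Op Λ}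
    (hA : A ∈ localAlgebra K) (hB : B ∈ localAlgebra L) :
    localTrace (K ∪ L) (A * B) = localTrace K A * localTrace L B := by
  have h := trace_mul_trace hKL hA hB
  have h2 : (2 : ℂ) ^ Fintype.card Λ ≠ 0 := by simp
  rw [localTrace, localTrace, localTrace, Finset.card_union_of_disjoint hKL, pow_add]
  field_simp
  linear_combination -h

end CAR

/-! ### Functional calculus of commuting self-adjoint matrices -/

section MatrixFunctionalCalculus

variable {n : Type*} [Fintype n] [DecidableEq n]

/-- The functional calculus of a self-adjoint matrix is given by a polynomial, which can be
prescribed to interpolate the function on a given finite set. -/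
theorem Matrix.exists_polynomial_cfc_eq (f : ℝ → ℝ) (s : Finset ℝ) :
    ∃ p : Polynomial ℝ, (∀ x ∈ s, p.eval x = f x) ∧
      ∀ A : Matrix n n ℂ, IsSelfAdjoint A → spectrum ℝ A ⊆ s →
        cfc f A = Polynomial.aeval A p := by
  refine ⟨Lagrange.interpolate s id f, fun x hx => ?_, fun A hA hs => ?_⟩
  · exact Lagrange.eval_interpolate_at_node f Function.injective_id.injOn hx
  · rw [← cfc_polynomial _ A hA]
    exact cfc_congr fun x hx =>
      (Lagrange.eval_interpolate_at_node f Function.injective_id.injOn (hs hx)).symm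

theorem Matrix.exists_finset_spectrum_subset (A : Matrix n n ℂ) :
    ∃ s : Finset ℝ, spectrum ℝ A ⊆ s :=
  ⟨A.finite_real_spectrum.toFinset, by simp⟩

theorem Matrix.aeval_mulVec {A : Matrix n n ℂ} {a : ℝ} {v : n → ℂ} (h : A.mulVec v = a • v)
    (p : Polynomial ℝ) : (Polynomial.aeval A p).mulVec v = p.eval a • v := by
  induction p using Polynomial.induction_on' with
  | add p q hp hq => rw [map_add, Matrix.add_mulVec, hp, hq, Polynomial.eval_add, add_smul]
  | monomial k c =>
    rw [Polynomial.aeval_monomial, Polynomial.eval_monomial, ← Algebra.smul_def,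
      Matrix.smul_mulVec, mul_smul]
    congr 1
    induction k with
    | zero => simp
    | succ k ih =>
      rw [pow_succ, ← Matrix.mulVec_mulVec, h, Matrix.mulVec_smul, ih, smul_smul, pow_succ,
        mul_comm]

theorem Matrix.cfc_mulVec {A : Matrix n n ℂ} (hA : IsSelfAdjoint A) (f : ℝ → ℝ) {a : ℝ}
    {v : n → ℂ} (h : A.mulVec v = a • v) : (cfc f A).mulVec v = f a • v := by
  obtain ⟨s, hs⟩ := A.exists_finset_spectrum_subset
  -- The node `a` is added because it need not lie in the spectrum when `v = 0`.
  obtain ⟨p, hp, hpA⟩ := Matrix.exists_polynomial_cfc_eq (n := n) f (insert a s)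
  rw [hpA A hA (hs.trans (by simp)), Matrix.aeval_mulVec h, hp a (by simp)]

/-- Two matrices agree if they agree on the joint eigenvectors of two commuting self-adjoint
matrices. -/
theorem Matrix.ext_of_joint_eigenvectors {A B M N : Matrix n n ℂ} (hA : IsSelfAdjoint A)
    (hB : IsSelfAdjoint B) (hAB : Commute A B)
    (h : ∀ (a b : ℝ) (v : n → ℂ), A.mulVec v = a • v → B.mulVec v = b • v →
      M.mulVec v = N.mulVec v) : M = N := by
  have hA' := Matrix.isSymmetric_toEuclideanLin_iff.2 hA
  have hB' := Matrix.isSymmetric_toEuclideanLin_iff.2 hB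
  have hc : Commute (Matrix.toEuclideanLin A) (Matrix.toEuclideanLin B) := by
    refine LinearMap.ext fun v => ?_
    simp [Matrix.toLpLin_apply, hAB.eq]
  have htop := LinearMap.IsSymmetric.iSup_iSup_eigenspace_inf_eigenspace_eq_top_of_commute
    hA' hB' hc
  apply Matrix.toEuclideanLin.injective
  rw [← LinearMap.eqLocus_eq_top, eq_top_iff, ← htop]
  refine iSup_le fun α => iSup_le fun β => fun v hv => ?_
  obtain ⟨h1, h2⟩ := hv
  rw [SetLike.mem_coe, Module.End.mem_eigenspace_iff] at h1 h2
  rw [LinearMap.mem_eqLocus]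
  rcases eq_or_ne v 0 with rfl | hv
  · simp
  have hα := hA'.conj_eigenvalue_eq_self (Module.End.hasEigenvalue_of_hasEigenvector
    ⟨Module.End.mem_eigenspace_iff.2 h1, hv⟩)
  have hβ := hB'.conj_eigenvalue_eq_self (Module.End.hasEigenvalue_of_hasEigenvector
    ⟨Module.End.mem_eigenspace_iff.2 h2, hv⟩)
  obtain ⟨a, rfl⟩ := Complex.conj_eq_iff_real.1 hα
  obtain ⟨b, rfl⟩ := Complex.conj_eq_iff_real.1 hβ
  have := h a b v.ofLp (congrArg WithLp.ofLp h1) (congrArg WithLp.ofLp h2)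
  exact congrArg (WithLp.toLp 2) this

/-- On a joint eigenvector this is `η(ab) = b η(a) + a η(b)`, valid for all real `a`, `b` because
`Real.log` is the logarithm of the absolute value. So self-adjointness suffices, without positivity.
-/
theorem Matrix.cfc_negMulLog_mul {A B : Matrix n n ℂ} (hA : IsSelfAdjoint A)
    (hB : IsSelfAdjoint B) (hAB : Commute A B) :
    cfc Real.negMulLog (A * B) = cfc Real.negMulLog A * B + A * cfc Real.negMulLog B := by
  refine Matrix.ext_of_joint_eigenvectors hA hB hAB fun a b v ha hb => ?_
  have hab : (A * B).mulVec v = (a * b) • v := by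
    rw [← Matrix.mulVec_mulVec, hb, Matrix.mulVec_smul, ha, smul_smul, mul_comm]
  rw [Matrix.cfc_mulVec ((hA.commute_iff hB).1 hAB) _ hab, Matrix.add_mulVec,
    ← Matrix.mulVec_mulVec, ← Matrix.mulVec_mulVec, hb, Matrix.mulVec_smul,
    Matrix.cfc_mulVec hA _ ha, Matrix.cfc_mulVec hB _ hb, Matrix.mulVec_smul, ha,
    smul_smul, smul_smul, ← add_smul, Real.negMulLog_mul, mul_comm a]

theorem Matrix.cfc_negMulLog_smul {A : Matrix n n ℂ} (hA : IsSelfAdjoint A) (r : ℝ) :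
    cfc Real.negMulLog (r • A) = Real.negMulLog r • A + r • cfc Real.negMulLog A := by
  rw [Algebra.smul_def, Matrix.cfc_negMulLog_mul (IsSelfAdjoint.algebraMap _ (.all r)) hA
    (Algebra.commutes r A), cfc_algebraMap, ← Algebra.smul_def, ← Algebra.smul_def]

/-- On a nonzero joint eigenvector `A * B = 0` forces one of the two eigenvalues to vanish, and `f 0
= 0` disposes of it. -/
theorem Matrix.cfc_add_of_mul_eq_zero {A B : Matrix n n ℂ} (hA : IsSelfAdjoint A)
    (hB : IsSelfAdjoint B) (hAB : A * B = 0) (f : ℝ → ℝ) (hf : f 0 = 0) :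
    cfc f (A + B) = cfc f A + cfc f B := by
  have hBA : B * A = 0 := by
    rw [← hA.star_eq, ← hB.star_eq, ← star_mul, hAB, star_zero]
  refine Matrix.ext_of_joint_eigenvectors hA hB (hAB.trans hBA.symm) fun a b v ha hb => ?_
  have hab : (A + B).mulVec v = (a + b) • v := by
    rw [Matrix.add_mulVec, ha, hb, add_smul]
  rw [Matrix.cfc_mulVec (hA.add hB) _ hab, Matrix.add_mulVec, Matrix.cfc_mulVec hA _ ha,
    Matrix.cfc_mulVec hB _ hb, ← add_smul]
  have h0 : (a * b) • v = 0 := by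
    rw [mul_comm, ← smul_smul, ← ha, ← Matrix.mulVec_smul, ← hb, Matrix.mulVec_mulVec, hAB,
      Matrix.zero_mulVec]
  rcases smul_eq_zero.1 h0 with h | rfl
  · rcases mul_eq_zero.1 h with rfl | rfl <;> simp [hf]
  · simp

theorem Matrix.cfc_sum_of_mul_eq_zero {ι : Type*} (s : Finset ι) (M : ι → Matrix n n ℂ)
    (hM : ∀ i, IsSelfAdjoint (M i)) (horth : Pairwise fun i j => M i * M j = 0)
    (f : ℝ → ℝ) (hf : f 0 = 0) :
    cfc f (∑ i ∈ s, M i) = ∑ i ∈ s, cfc f (M i) := by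
  classical
  induction s using Finset.induction_on with
  | empty =>
    have h := cfc_algebraMap (A := Matrix n n ℂ) (0 : ℝ) f
    rwa [hf, map_zero] at h
  | insert i s hi ih =>
    rw [Finset.sum_insert hi, Finset.sum_insert hi, ← ih]
    refine Matrix.cfc_add_of_mul_eq_zero (hM i) (isSelfAdjoint_sum s fun j _ => hM j) ?_ f hf
    rw [Finset.mul_sum]
    exact Finset.sum_eq_zero fun j hj => horth (by rintro rfl; exact hi hj)

end MatrixFunctionalCalculus

/-! ### Normalized trace and product densities -/

namespace CAR

section LocalTrace

variable {Λ : Type*} [Fintype Λ]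

theorem localTrace_mul_comm (K : Finset Λ) (X Y : Op Λ) :
    localTrace K (X * Y) = localTrace K (Y * X) := by
  rw [localTrace, localTrace, Matrix.trace_mul_comm]

theorem localTrace_add (K : Finset Λ) (X Y : Op Λ) :
    localTrace K (X + Y) = localTrace K X + localTrace K Y := by
  rw [localTrace, Matrix.trace_add, mul_add]; rfl

theorem localTrace_sub (K : Finset Λ) (X Y : Op Λ) :
    localTrace K (X - Y) = localTrace K X - localTrace K Y := by
  rw [localTrace, Matrix.trace_sub, mul_sub]; rfl

theorem localTrace_smul (K : Finset Λ) (c : ℂ) (X : Op Λ) :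
    localTrace K (c • X) = c * localTrace K X := by
  rw [localTrace, localTrace, Matrix.trace_smul, smul_eq_mul, mul_left_comm]

theorem localTrace_sum (K : Finset Λ) {ι : Type*} (s : Finset ι) (X : ι → Op Λ) :
    localTrace K (∑ i ∈ s, X i) = ∑ i ∈ s, localTrace K (X i) := by
  simp only [localTrace, Matrix.trace_sum, Finset.mul_sum]

theorem localTrace_star (K : Finset Λ) (X : Op Λ) :
    localTrace K (star X) = star (localTrace K X) := by
  rw [localTrace, localTrace, Matrix.star_eq_conjTranspose, Matrix.trace_conjTranspose]
  simp

end LocalTrace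

variable {Λ : Type*} [Fintype Λ] [LinearOrder Λ]

theorem localTrace_parity_conj (K : Finset Λ) (X : Op Λ) :
    localTrace K (parity Λ * X * parity Λ) = localTrace K X := by
  rw [localTrace_mul_comm, ← mul_assoc, parity_mul_parity, one_mul]

/-- The trace is faithful. -/
theorem eq_zero_of_localTrace_mul_eq_zero {K : Finset Λ} {D : Op Λ} (hD : D ∈ localAlgebra K)
    (h : ∀ X ∈ localAlgebra K, localTrace K (D * X) = 0) : D = 0 := by
  have h1 := h (star D) (star_mem hD)
  have hc : (2 : ℂ) ^ K.card / (2 : ℂ) ^ Fintype.card Λ ≠ 0 := by simp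
  have h2 := (mul_eq_zero.1 h1).resolve_left hc
  rwa [Matrix.star_eq_conjTranspose, Matrix.trace_mul_conjTranspose_self_eq_zero_iff] at h2

theorem eq_of_localTrace_mul_eq {K : Finset Λ} {D E : Op Λ} (hD : D ∈ localAlgebra K)
    (hE : E ∈ localAlgebra K)
    (h : ∀ X ∈ localAlgebra K, localTrace K (D * X) = localTrace K (E * X)) : D = E := by
  rw [← sub_eq_zero]
  refine eq_zero_of_localTrace_mul_eq_zero (sub_mem hD hE) fun X hX => ?_
  rw [sub_mul, localTrace_sub, h X hX, sub_self]

theorem cfc_mem {K : Finset Λ} {D : Op Λ} (hD : D ∈ localAlgebra K) (hsa : IsSelfAdjoint D)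
    (f : ℝ → ℝ) : cfc f D ∈ localAlgebra K := by
  obtain ⟨s, hs⟩ := D.exists_finset_spectrum_subset
  obtain ⟨p, -, hp⟩ := Matrix.exists_polynomial_cfc_eq (n := Finset Λ) f s
  rw [hp D hsa hs]
  clear hp
  induction p using Polynomial.induction_on' with
  | add p q hp hq => rw [map_add]; exact add_mem hp hq
  | monomial k c =>
    rw [Polynomial.aeval_monomial, IsScalarTower.algebraMap_apply ℝ ℂ (Op Λ)]
    exact mul_mem (algebraMap_mem _ _) (pow_mem hD k)

theorem commute_of_even_or_even {K L : Finset Λ} (hKL : Disjoint K L) {X Y : Op Λ}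
    (hX : X ∈ localAlgebra K) (hY : Y ∈ localAlgebra L)
    (h : Commute X (parity Λ) ∨ Commute Y (parity Λ)) : Commute X Y :=
  h.elim (commute_of_even hKL hX hY) fun h => (commute_of_even hKL.symm hY hX h).symm

/-- If one of two density matrices of disjoint regions is even, then their product is the density
matrix of the product functional. -/
theorem localTrace_mul_mul_mul {K L : Finset Λ} (hKL : Disjoint K L) {D E A B : Op Λ}
    (hD : D ∈ localAlgebra K) (hE : E ∈ localAlgebra L)
    (h : Commute D (parity Λ) ∨ Commute E (parity Λ))
    (hA : A ∈ localAlgebra K) (hB : B ∈ localAlgebra L) :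
    localTrace (K ∪ L) (D * E * (A * B)) = localTrace K (D * A) * localTrace L (E * B) := by
  rcases h with h | h
  · have hc := commute_of_even hKL hD hE h
    rw [hc.eq, localTrace_mul_comm L E B, ← localTrace_mul hKL (mul_mem hD hA) (mul_mem hB hE),
      mul_assoc, localTrace_mul_comm]
    simp only [mul_assoc]
  · have hc := commute_of_even hKL.symm hE hA h
    rw [← localTrace_mul hKL (mul_mem hD hA) (mul_mem hE hB)]
    simp only [mul_assoc]
    rw [← mul_assoc E A, hc.eq, mul_assoc]

/-- An odd element anticommutes with each generator of the other region, so passing it through `Y`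
applies the grading automorphism to `Y`. -/
theorem mul_eq_mul_parity_conj_of_odd {K L : Finset Λ} (hKL : Disjoint K L) {X Y : Op Λ}
    (hX : X ∈ localAlgebra K) (hY : Y ∈ localAlgebra L) (h : parity Λ * X * parity Λ = -X) :
    Y * X = X * (parity Λ * Y * parity Λ) := by
  have hp (Z : Op Λ) : parity Λ * (parity Λ * Z) = Z := by
    rw [← mul_assoc, parity_mul_parity, one_mul]
  induction hY using localAlgebra_induction with
  | ann j hj =>
    rw [annihilation_mul_eq hX (Finset.disjoint_right.1 hKL hj), h, parity_mul_annihilation,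
      neg_mul, neg_mul, mul_assoc (annihilation j), parity_mul_parity, mul_one, mul_neg]
  | cre j hj =>
    rw [star_annihilation_mul_eq hX (Finset.disjoint_right.1 hKL hj), h,
      parity_mul_star_annihilation, neg_mul, neg_mul, mul_assoc (star (annihilation j)),
      parity_mul_parity, mul_one, mul_neg]
  | algebraMap c =>
    rw [← Algebra.commutes c (parity Λ), mul_assoc (algebraMap ℂ (Op Λ) c), parity_mul_parity,
      mul_one, Algebra.commutes]
  | add Y Z _ _ hY hZ => rw [add_mul, hY, hZ, mul_add, add_mul, mul_add]
  | mul Y Z _ _ hY hZ =>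
    rw [mul_assoc, hZ, ← mul_assoc, hY]
    simp only [mul_assoc, hp]

/-! ### Densities, parity and supports of states -/

namespace State

variable {K : Finset Λ}

theorem density_mem (φ : State K) : φ.density ∈ localAlgebra K :=
  (exists_density K φ.toFun).choose.2

theorem apply_eq (φ : State K) (X : localAlgebra K) :
    φ X = localTrace K (φ.density * X) :=
  (exists_density K φ.toFun).choose_spec X

theorem density_eq_of_apply (φ : State K) {D : Op Λ} (hD : D ∈ localAlgebra K)
    (h : ∀ X : localAlgebra K, φ X = localTrace K (D * X)) : φ.density = D :=
  eq_of_localTrace_mul_eq φ.density_mem hD fun X hX => by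
    rw [← φ.apply_eq ⟨X, hX⟩, h]

theorem localTrace_density (φ : State K) : localTrace K φ.density = 1 := by
  have := φ.apply_eq 1
  rw [φ.map_one] at this
  simpa using this.symm

theorem apply_star (φ : State K) (X : localAlgebra K) : φ (star X) = star (φ X) := by
  -- Polarization: the values on `X⋆X`, `(1 + X)⋆(1 + X)` and `(1 + iX)⋆(1 + iX)` are real.
  have h0 := (Complex.nonneg_iff.1 (φ.nonneg X)).2
  have h1 := (Complex.nonneg_iff.1 (φ.nonneg (1 + X))).2
  have h2 := (Complex.nonneg_iff.1 (φ.nonneg (1 + Complex.I • X))).2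
  simp only [star_add, star_one, star_smul, add_mul, mul_add, one_mul, mul_one, map_add,
    map_smul, φ.map_one, smul_mul_assoc, mul_smul_comm, smul_eq_mul, Complex.add_im,
    Complex.mul_im, Complex.star_def, Complex.conj_I, Complex.neg_re, Complex.neg_im,
    Complex.I_re, Complex.I_im, Complex.one_im, Complex.mul_re] at h0 h1 h2
  apply Complex.ext <;> simp <;> linarith

theorem isSelfAdjoint_density (φ : State K) : IsSelfAdjoint φ.density := by
  refine (φ.density_eq_of_apply (star_mem φ.density_mem) fun X => ?_).symm
  have h := congrArg star (φ.apply_star X)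
  rw [star_star, φ.apply_eq, ← localTrace_star, star_mul, localTrace_mul_comm] at h
  rw [← h]
  simp

/-- A state whose density matrix is not even is non-zero on some odd element. -/
theorem exists_odd (φ : State K) (h : ¬ Commute φ.density (parity Λ)) :
    ∃ X : localAlgebra K, parity Λ * X * parity Λ = -(X : Op Λ) ∧ φ X ≠ 0 := by
  by_contra! hodd
  apply h
  have h' : φ.density = parity Λ * φ.density * parity Λ := by
    refine φ.density_eq_of_apply (parity_conj_mem φ.density_mem) fun X => ?_
    have hp (Y : Op Λ) : parity Λ * (parity Λ * Y) = Y := by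
      rw [← mul_assoc, parity_mul_parity, one_mul]
    -- Twice the odd part of `X`; that `φ` kills it means `φ` is invariant under parity conjugation.
    have h1 := hodd ⟨X - parity Λ * X * parity Λ, sub_mem X.2 (parity_conj_mem X.2)⟩ (by
      simp only [mul_sub, sub_mul, mul_assoc, hp, parity_mul_parity, mul_one, neg_sub])
    rw [φ.apply_eq, mul_sub, localTrace_sub, sub_eq_zero] at h1
    rw [φ.apply_eq, h1, ← localTrace_parity_conj]
    simp only [mul_assoc, parity_mul_parity, mul_one]
  have := congrArg (· * parity Λ) h'
  simp only [mul_assoc, parity_mul_parity, mul_one] at this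
  exact this

/-- A functional on a larger algebra that factorizes over two disjoint regions forces one of the
two states to be even. -/
theorem even_or_even {L M : Finset Λ} (hKL : Disjoint K L) (hK : K ⊆ M) (hL : L ⊆ M)
    (ω : State M) (φ : State K) (ψ : State L)
    (h : ∀ A B, ω (incl hK A * incl hL B) = φ A * ψ B) :
    Commute φ.density (parity Λ) ∨ Commute ψ.density (parity Λ) := by
  by_contra! hne
  obtain ⟨A, hA, hφ⟩ := φ.exists_odd hne.1
  obtain ⟨B, hB, hψ⟩ := ψ.exists_odd hne.2
  -- Adjoints of odd elements are odd, so `(AB)⋆ = B⋆A⋆ = -A⋆B⋆`. Hermiticity of `ω` then makes the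
  -- conjugate of `φ(A)ψ(B)` equal to its own negative.
  have hanti : star (incl hK A * incl hL B) = -(incl hK (star A) * incl hL (star B)) := by
    rw [star_mul, ← map_star, ← map_star]
    apply Subtype.ext
    change star (B : Op Λ) * star (A : Op Λ) = -(star (A : Op Λ) * star (B : Op Λ))
    have hodd (X : Op Λ) (hX : parity Λ * X * parity Λ = -X) :
        parity Λ * star X * parity Λ = -star X := by
      rw [← star_neg, ← hX, star_mul, star_mul, star_parity, mul_assoc]
    rw [mul_eq_mul_parity_conj_of_odd hKL (star_mem A.2) (star_mem B.2) (hodd A hA),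
      hodd B hB, mul_neg]
  have h1 := ω.apply_star (incl hK A * incl hL B)
  rw [hanti, map_neg, h, h, φ.apply_star, ψ.apply_star, ← star_mul'] at h1
  have h2 : star (φ A * ψ B) = 0 := self_eq_neg.1 h1.symm
  exact mul_ne_zero hφ hψ (star_eq_zero.1 h2)

/-- A Cauchy–Schwarz argument: as `φ q = 0`, the quadratic term in `t` drops out, and an affine
function of `t` that stays nonnegative has zero slope. -/
theorem apply_mul_eq_zero (φ : State K) {q : localAlgebra K} (hq : IsStarProjection q)
    (h : φ q = 0) (X : localAlgebra K) : φ (X * q) = 0 := by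
  by_contra hne
  set z := φ (X * q) with hz
  have hz' : φ (q * star X) = star z := by
    rw [hz, ← φ.apply_star, star_mul, hq.isSelfAdjoint.star_eq]
  have key (t : ℝ) : 0 ≤ (φ (X * star X)).re - 2 * t * Complex.normSq z := by
    have h1 := (Complex.nonneg_iff.1 (φ.nonneg (star X - ((t : ℂ) * star z) • q))).1
    simp only [star_sub, star_smul, star_star, hq.isSelfAdjoint.star_eq, sub_mul, mul_sub,
      smul_mul_assoc, mul_smul_comm, hq.isIdempotentElem.eq, map_sub, map_smul, h, hz',
      ← hz, smul_eq_mul] at h1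
    convert h1 using 1
    simp [Complex.normSq_apply]
    ring
  have hpos : 0 < Complex.normSq z := Complex.normSq_pos.2 hne
  -- This `t` makes the affine expression equal to `-1`.
  have h2 := key (((φ (X * star X)).re + 1) / (2 * Complex.normSq z))
  field_simp at h2
  linarith

theorem mul_density_of_isSupport (φ : State K) {p : localAlgebra K} (hp : φ.IsSupport p) :
    (p : Op Λ) * φ.density = φ.density := by
  have h0 : φ (1 - p) = 0 := by rw [map_sub, φ.map_one, hp.2.1, sub_self]
  have h1 : ((1 - p : localAlgebra K) : Op Λ) * φ.density = 0 := by
    refine eq_zero_of_localTrace_mul_eq_zero (mul_mem (1 - p : localAlgebra K).2 φ.density_mem)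
      fun X hX => ?_
    have := φ.apply_mul_eq_zero hp.1.one_sub h0 ⟨X, hX⟩
    rw [φ.apply_eq] at this
    rw [mul_assoc, localTrace_mul_comm, mul_assoc]
    exact this
  have h2 : (1 - (p : Op Λ)) * φ.density = 0 := h1
  rw [sub_mul, one_mul, sub_eq_zero] at h2
  exact h2.symm

/-- The supports can be inserted between the densities: `D_φ D_ψ = D_φ p q D_ψ`. -/
theorem Orthogonal.density_mul {φ ψ : State K} (h : φ.Orthogonal ψ) :
    φ.density * ψ.density = 0 := by
  obtain ⟨p, q, hp, hq, hpq⟩ := h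
  have h1 := congrArg star (φ.mul_density_of_isSupport hp)
  have hpsa : star (p : Op Λ) = p := congrArg Subtype.val hp.1.isSelfAdjoint.star_eq
  rw [star_mul, φ.isSelfAdjoint_density.star_eq, hpsa] at h1
  have hpq' : (p : Op Λ) * q = 0 := congrArg Subtype.val hpq
  rw [← h1, ← ψ.mul_density_of_isSupport hq, mul_assoc, ← mul_assoc (p : Op Λ), hpq',
    zero_mul, mul_zero]

/-- The entropy of a mixture of mutually orthogonal density matrices. -/
theorem entropy_eq_sum (φ : State K) {ι : Type*} [Fintype ι] (lam : ι → ℝ) (E : ι → Op Λ)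
    (hE : ∀ i, IsSelfAdjoint (E i)) (htr : ∀ i, localTrace K (E i) = 1)
    (horth : Pairwise fun i j => E i * E j = 0)
    (hφ : φ.density = ∑ i, (lam i : ℂ) • E i) :
    φ.entropy = ∑ i, (Real.negMulLog (lam i) +
      lam i * (localTrace K (cfc Real.negMulLog (E i))).re) := by
  have h1 : φ.density = ∑ i, lam i • E i := hφ
  rw [entropy, h1, Matrix.cfc_sum_of_mul_eq_zero _ _ (fun i => (IsSelfAdjoint.all (lam i)).smul (hE i)) ?_ _
    Real.negMulLog_zero, localTrace_sum, Complex.re_sum]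
  · refine Finset.sum_congr rfl fun i _ => ?_
    rw [Matrix.cfc_negMulLog_smul (hE i), localTrace_add, ← Complex.coe_smul,
      ← Complex.coe_smul, localTrace_smul, localTrace_smul, htr, mul_one, Complex.add_re,
      Complex.ofReal_re, Complex.re_ofReal_mul]
  · intro i j hij
    rw [smul_mul_smul_comm, horth hij, smul_zero]

end State

/-! ### Additivity of entropy and partial traces -/

theorem localTrace_cfc_negMulLog_mul {K L : Finset Λ} (hKL : Disjoint K L) {D E : Op Λ}
    (hD : D ∈ localAlgebra K) (hE : E ∈ localAlgebra L) (hDsa : IsSelfAdjoint D)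
    (hEsa : IsSelfAdjoint E) (hDE : Commute D E) (hDtr : localTrace K D = 1)
    (hEtr : localTrace L E = 1) :
    localTrace (K ∪ L) (cfc Real.negMulLog (D * E)) =
      localTrace K (cfc Real.negMulLog D) + localTrace L (cfc Real.negMulLog E) := by
  rw [Matrix.cfc_negMulLog_mul hDsa hEsa hDE, localTrace_add,
    localTrace_mul hKL (cfc_mem hD hDsa _) hE, localTrace_mul hKL hD (cfc_mem hE hEsa _),
    hDtr, hEtr, one_mul, mul_one]

theorem localTrace_mul_eq_of_forall {K L M : Finset Λ} (U : Finset Λ) {D E : Op Λ}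
    (h : ∀ A ∈ localAlgebra K, ∀ B ∈ localAlgebra L, ∀ C ∈ localAlgebra M,
      localTrace U (D * (A * B * C)) = localTrace U (E * (A * B * C)))
    {X : Op Λ} (hX : X ∈ localAlgebra (K ∪ L ∪ M)) :
    localTrace U (D * X) = localTrace U (E * X) := by
  have hs := mem_span_mul hX
  clear hX
  induction hs using Submodule.span_induction with
  | mem Z hZ =>
    obtain ⟨Y, hY, C, hC, rfl⟩ := hZ
    have hs := mem_span_mul hY
    clear hY
    induction hs using Submodule.span_induction with
    | mem Z hZ =>
      obtain ⟨A, hA, B, hB, rfl⟩ := hZ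
      exact h A hA B hB C hC
    | zero => simp
    | add Y Z _ _ hY hZ => simp only [add_mul, mul_add, localTrace_add, hY, hZ]
    | smul c Z _ hZ => simp only [smul_mul_assoc, mul_smul_comm, localTrace_smul, hZ]
  | zero => simp
  | add Y Z _ _ hY hZ => simp only [mul_add, localTrace_add, hY, hZ]
  | smul c Z _ hZ => simp only [mul_smul_comm, localTrace_smul, hZ]

/-- The density matrix of a restricted state is the partial trace. -/
theorem State.density_restrict {K M U : Finset Λ} (hKM : Disjoint K M) (hU : K ∪ M = U)
    (ω : State U) (hK : K ⊆ U) {ι : Type*} [Fintype ι] (c : ι → ℂ) (D E : ι → Op Λ)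
    (hD : ∀ i, D i ∈ localAlgebra K) (hE : ∀ i, E i ∈ localAlgebra M)
    (htr : ∀ i, localTrace M (E i) = 1) (hω : ω.density = ∑ i, c i • (D i * E i)) :
    (ω.restrict hK).density = ∑ i, c i • D i := by
  subst hU
  refine State.density_eq_of_apply _ (sum_mem fun i _ => SMulMemClass.smul_mem _ (hD i))
    fun X => ?_
  change ω (incl hK X) = _
  rw [ω.apply_eq, hω]
  change localTrace _ (_ * (X : Op Λ)) = _
  simp only [Finset.sum_mul, localTrace_sum, smul_mul_assoc, localTrace_smul]
  refine Finset.sum_congr rfl fun i _ => ?_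
  rw [localTrace_mul_comm, ← mul_assoc, localTrace_mul hKM (mul_mem X.2 (hD i)) (hE i), htr,
    mul_one, localTrace_mul_comm]

/-! ### Densities of product state extensions -/

namespace IsProductExtension

variable {I J : Finset Λ} {ω : State (I ∪ J)} {ω₁ : State (I \ J)} {ω₂ : State (I ∩ J)}
  {ω₃ : State (J \ I)}

theorem even_left_mid (h : IsProductExtension ω ω₁ ω₂ ω₃) :
    Commute ω₁.density (parity Λ) ∨ Commute ω₂.density (parity Λ) :=
  State.even_or_even (Finset.disjoint_sdiff_inter I J) _ _ ω ω₁ ω₂ fun A B => by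
    simpa [ω₃.map_one] using h A B 1

theorem even_left_right (h : IsProductExtension ω ω₁ ω₂ ω₃) :
    Commute ω₁.density (parity Λ) ∨ Commute ω₃.density (parity Λ) :=
  State.even_or_even disjoint_sdiff_sdiff _ _ ω ω₁ ω₃ fun A C => by
    simpa [ω₂.map_one] using h A 1 C

theorem even_mid_right (h : IsProductExtension ω ω₁ ω₂ ω₃) :
    Commute ω₂.density (parity Λ) ∨ Commute ω₃.density (parity Λ) :=
  State.even_or_even (Finset.inter_comm I J ▸ (Finset.disjoint_sdiff_inter J I).symm) _ _
    ω ω₂ ω₃ fun B C => by simpa [ω₁.map_one] using h 1 B C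

theorem commute_left_mid (h : IsProductExtension ω ω₁ ω₂ ω₃) :
    Commute ω₁.density ω₂.density :=
  commute_of_even_or_even (Finset.disjoint_sdiff_inter I J) ω₁.density_mem ω₂.density_mem
    h.even_left_mid

theorem commute_left_right (h : IsProductExtension ω ω₁ ω₂ ω₃) :
    Commute ω₁.density ω₃.density :=
  commute_of_even_or_even disjoint_sdiff_sdiff ω₁.density_mem ω₃.density_mem h.even_left_right

theorem commute_mid_right (h : IsProductExtension ω ω₁ ω₂ ω₃) :
    Commute ω₂.density ω₃.density :=
  commute_of_even_or_even (Finset.inter_comm I J ▸ (Finset.disjoint_sdiff_inter J I).symm)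
    ω₂.density_mem ω₃.density_mem h.even_mid_right

/-- The density matrix of a product state extension is the product of the density matrices. -/
theorem density_eq (h : IsProductExtension ω ω₁ ω₂ ω₃) :
    ω.density = ω₁.density * ω₂.density * ω₃.density := by
  have hIJ : I \ J ∪ I ∩ J = I := Finset.sdiff_union_inter I J
  have hU : I \ J ∪ I ∩ J ∪ J \ I = I ∪ J := by rw [hIJ, Finset.union_sdiff_self_eq_union]
  have hd : Disjoint (I \ J ∪ I ∩ J) (J \ I) := hIJ.symm ▸ Finset.disjoint_sdiff
  have h12 : ω₁.density * ω₂.density ∈ localAlgebra (I \ J ∪ I ∩ J) :=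
    mul_mem (localAlgebra_mono Finset.subset_union_left ω₁.density_mem)
      (localAlgebra_mono Finset.subset_union_right ω₂.density_mem)
  refine eq_of_localTrace_mul_eq ω.density_mem ?_ fun X hX => ?_
  · rw [← hU]
    exact mul_mem (localAlgebra_mono Finset.subset_union_left h12)
      (localAlgebra_mono Finset.subset_union_right ω₃.density_mem)
  rw [← hU] at hX
  refine localTrace_mul_eq_of_forall _ (fun A hA B hB C hC => ?_) hX
  have h1 := h ⟨A, hA⟩ ⟨B, hB⟩ ⟨C, hC⟩
  rw [ω.apply_eq, ω₁.apply_eq, ω₂.apply_eq, ω₃.apply_eq] at h1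
  refine h1.trans ?_
  -- At most one of the three densities is not even, so either the third is even or the first two
  -- both are.
  have heven : Commute (ω₁.density * ω₂.density) (parity Λ) ∨
      Commute ω₃.density (parity Λ) := by
    rcases h.even_left_right with h1 | h3
    · rcases h.even_mid_right with h2 | h3
      · exact Or.inl (h1.mul_left h2)
      · exact Or.inr h3
    · exact Or.inr h3
  rw [← hU, localTrace_mul_mul_mul hd h12 ω₃.density_mem heven
    (mul_mem (localAlgebra_mono Finset.subset_union_left hA)
      (localAlgebra_mono Finset.subset_union_right hB)) hC,
    localTrace_mul_mul_mul (Finset.disjoint_sdiff_inter I J) ω₁.density_mem ω₂.density_mem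
      h.even_left_mid hA hB]

end IsProductExtension

end CAR

/-! ### Equality in strong subadditivity -/

theorem mainTheorem2 {Λ : Type*} [Fintype Λ] [LinearOrder Λ] (I J : Finset Λ)
    {ι : Type*} [Fintype ι] (lam : ι → ℝ) (hlam : ∀ i, 0 < lam i) (hsum : ∑ i, lam i = 1)
    (ω₁ : ι → CAR.State (I \ J)) (ω₂ : ι → CAR.State (I ∩ J)) (ω₃ : ι → CAR.State (J \ I))
    (h₁ : Pairwise fun i j => (ω₁ i).Orthogonal (ω₁ j))
    (h₂ : Pairwise fun i j => (ω₂ i).Orthogonal (ω₂ j))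
    (h₃ : Pairwise fun i j => (ω₃ i).Orthogonal (ω₃ j))
    (prod : ι → CAR.State (I ∪ J))
    (hprod : ∀ i, CAR.IsProductExtension (prod i) (ω₁ i) (ω₂ i) (ω₃ i))
    (ω : CAR.State (I ∪ J))
    (hω : ∀ X : CAR.localAlgebra (I ∪ J), ω X = ∑ i, (lam i : ℂ) * prod i X) :
    ω.entropy + (ω.restrict (Finset.inter_subset_left.trans Finset.subset_union_left :
        I ∩ J ⊆ I ∪ J)).entropy =
      (ω.restrict (Finset.subset_union_left : I ⊆ I ∪ J)).entropy +
        (ω.restrict (Finset.subset_union_right : J ⊆ I ∪ J)).entropy := by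
  have hI : I \ J ∪ I ∩ J = I := Finset.sdiff_union_inter I J
  have hJ : I ∩ J ∪ J \ I = J := by
    rw [Finset.inter_comm, Finset.union_comm, Finset.sdiff_union_inter]
  have hU : I ∪ J \ I = I ∪ J := Finset.union_sdiff_self_eq_union
  have hU' : J ∪ I \ J = I ∪ J := by rw [Finset.union_sdiff_self_eq_union, Finset.union_comm]
  have d12 : Disjoint (I \ J) (I ∩ J) := Finset.disjoint_sdiff_inter I J
  have d13 : Disjoint (I \ J) (J \ I) := disjoint_sdiff_sdiff
  have d23 : Disjoint (I ∩ J) (J \ I) :=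
    Finset.inter_comm I J ▸ (Finset.disjoint_sdiff_inter J I).symm
  have m1 i := (ω₁ i).density_mem
  have m2 i := (ω₂ i).density_mem
  have m3 i := (ω₃ i).density_mem
  have t1 i := (ω₁ i).localTrace_density
  have t2 i := (ω₂ i).localTrace_density
  have t3 i := (ω₃ i).localTrace_density
  have s1 i := (ω₁ i).isSelfAdjoint_density
  have s2 i := (ω₂ i).isSelfAdjoint_density
  have s3 i := (ω₃ i).isSelfAdjoint_density
  have c12 i := (hprod i).commute_left_mid
  have c13 i := (hprod i).commute_left_right
  have c23 i := (hprod i).commute_mid_right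
  have o2 {i j : ι} (hij : i ≠ j) : (ω₂ i).density * (ω₂ j).density = 0 := (h₂ hij).density_mul
  have m12 i : (ω₁ i).density * (ω₂ i).density ∈ CAR.localAlgebra I :=
    mul_mem (CAR.localAlgebra_mono Finset.sdiff_subset (m1 i))
      (CAR.localAlgebra_mono Finset.inter_subset_left (m2 i))
  have m23 i : (ω₂ i).density * (ω₃ i).density ∈ CAR.localAlgebra J :=
    mul_mem (CAR.localAlgebra_mono Finset.inter_subset_right (m2 i))
      (CAR.localAlgebra_mono Finset.sdiff_subset (m3 i))
  have t12 i : CAR.localTrace I ((ω₁ i).density * (ω₂ i).density) = 1 := by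
    have := CAR.localTrace_mul d12 (m1 i) (m2 i)
    rwa [hI, t1, t2, one_mul] at this
  have t23 i : CAR.localTrace J ((ω₂ i).density * (ω₃ i).density) = 1 := by
    have := CAR.localTrace_mul d23 (m2 i) (m3 i)
    rwa [hJ, t2, t3, one_mul] at this
  have t13 i : CAR.localTrace (I \ J ∪ J \ I) ((ω₁ i).density * (ω₃ i).density) = 1 := by
    rw [CAR.localTrace_mul d13 (m1 i) (m3 i), t1, t3, one_mul]
  have t123 i : CAR.localTrace (I ∪ J) ((ω₁ i).density * (ω₂ i).density * (ω₃ i).density) = 1 := by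
    have := CAR.localTrace_mul Finset.disjoint_sdiff (m12 i) (m3 i)
    rwa [hU, t12, t3, one_mul] at this
  have s12 i : IsSelfAdjoint ((ω₁ i).density * (ω₂ i).density) :=
    ((s1 i).commute_iff (s2 i)).1 (c12 i)
  have s23 i : IsSelfAdjoint ((ω₂ i).density * (ω₃ i).density) :=
    ((s2 i).commute_iff (s3 i)).1 (c23 i)
  have c123 i : Commute ((ω₁ i).density * (ω₂ i).density) (ω₃ i).density :=
    (c13 i).mul_left (c23 i)
  have s123 i : IsSelfAdjoint ((ω₁ i).density * (ω₂ i).density * (ω₃ i).density) :=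
    ((s12 i).commute_iff (s3 i)).1 (c123 i)
  have o12 : Pairwise fun i j => (ω₁ i).density * (ω₂ i).density *
      ((ω₁ j).density * (ω₂ j).density) = 0 := fun i j hij => by
    beta_reduce
    -- Commuting the factors of one term brings the two middle densities next to each other, where
    -- they annihilate.
    rw [(c12 j).eq, mul_assoc, ← mul_assoc (ω₂ i).density, o2 hij, zero_mul, mul_zero]
  have o23 : Pairwise fun i j => (ω₂ i).density * (ω₃ i).density *
      ((ω₂ j).density * (ω₃ j).density) = 0 := fun i j hij => by
    beta_reduce
    rw [(c23 i).eq, mul_assoc, ← mul_assoc (ω₂ i).density, o2 hij, zero_mul, mul_zero]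
  have o123 : Pairwise fun i j => (ω₁ i).density * (ω₂ i).density * (ω₃ i).density *
      ((ω₁ j).density * (ω₂ j).density * (ω₃ j).density) = 0 := fun i j hij => by
    beta_reduce
    rw [(c123 i).eq, mul_assoc, ← mul_assoc (_ * _) (_ * _) (ω₃ j).density, o12 hij, zero_mul,
      mul_zero]
  have hden : ω.density = ∑ i, (lam i : ℂ) •
      ((ω₁ i).density * (ω₂ i).density * (ω₃ i).density) := by
    simp only [← (hprod _).density_eq]
    refine ω.density_eq_of_apply
      (sum_mem fun i _ => SMulMemClass.smul_mem _ (prod i).density_mem) fun X => ?_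
    simp only [hω, Finset.sum_mul, CAR.localTrace_sum, smul_mul_assoc, CAR.localTrace_smul,
      CAR.State.apply_eq]
  have hdenI : (ω.restrict (Finset.subset_union_left : I ⊆ I ∪ J)).density =
      ∑ i, (lam i : ℂ) • ((ω₁ i).density * (ω₂ i).density) :=
    ω.density_restrict Finset.disjoint_sdiff hU _ _ _ _ m12 m3 t3 hden
  have hdenJ : (ω.restrict (Finset.subset_union_right : J ⊆ I ∪ J)).density =
      ∑ i, (lam i : ℂ) • ((ω₂ i).density * (ω₃ i).density) := by
    refine ω.density_restrict Finset.disjoint_sdiff hU' _ _ _ _ m23 m1 t1 (hden.trans ?_)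
    refine Finset.sum_congr rfl fun i _ => ?_
    rw [mul_assoc, ((c12 i).mul_right (c13 i)).eq]
  have hdenIJ : (ω.restrict (Finset.inter_subset_left.trans Finset.subset_union_left :
      I ∩ J ⊆ I ∪ J)).density = ∑ i, (lam i : ℂ) • (ω₂ i).density := by
    -- The region traced out is the symmetric difference of `I` and `J`, with density `D₁ᵢ D₃ᵢ` once
    -- `D₂ᵢ` is moved to the front.
    refine ω.density_restrict (M := I \ J ∪ J \ I) (Finset.disjoint_union_right.2 ⟨d12.symm, d23⟩)
      ?_ _ _ _ _ m2 (fun i => mul_mem (CAR.localAlgebra_mono Finset.subset_union_left (m1 i))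
        (CAR.localAlgebra_mono Finset.subset_union_right (m3 i))) t13 (hden.trans ?_)
    · rw [← Finset.union_assoc, Finset.union_comm (I ∩ J), hI, hU]
    · refine Finset.sum_congr rfl fun i _ => ?_
      rw [(c12 i).eq, mul_assoc]
  have e12 i := CAR.localTrace_cfc_negMulLog_mul d12 (m1 i) (m2 i) (s1 i) (s2 i) (c12 i) (t1 i) (t2 i)
  have e23 i := CAR.localTrace_cfc_negMulLog_mul d23 (m2 i) (m3 i) (s2 i) (s3 i) (c23 i) (t2 i) (t3 i)
  have e123 i := CAR.localTrace_cfc_negMulLog_mul Finset.disjoint_sdiff (m12 i) (m3 i) (s12 i) (s3 i)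
    (c123 i) (t12 i) (t3 i)
  rw [hI] at e12
  rw [hJ] at e23
  rw [hU] at e123
  rw [CAR.State.entropy_eq_sum _ lam _ s123 t123 o123 hden,
    CAR.State.entropy_eq_sum _ lam _ s2 t2 (fun i j hij => o2 hij) hdenIJ,
    CAR.State.entropy_eq_sum _ lam _ s12 t12 o12 hdenI,
    CAR.State.entropy_eq_sum _ lam _ s23 t23 o23 hdenJ,
    ← Finset.sum_add_distrib, ← Finset.sum_add_distrib]
  refine Finset.sum_congr rfl fun i _ => ?_
  rw [e123, e12, e23]
  simp only [Complex.add_re]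
  ring
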